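/- Let $N\ge 1$. (Complex case.) For real angles $\theta=(\theta_{jp})_{2\le j\le N,\ 1\le p\le 2j-2}$ let $L$ be the complex lower triangular $N\times N$ matrix with entries $$l_{jk}=(\cos\theta_{j,2k-1}+i\cos\theta_{j,2k}\sin\theta_{j,2k-1})\prod_{p=1}^{2k-2}\sin\theta_{jp}\quad(1\le k\le j-1),\qquad l_{jj}=\prod_{p=1}^{2j-2}\sin\theta_{jp},$$ where empty products equal $1$ (each row is a point of the unit sphere of $\mathbb R^{2j-1}$ in hyperspherical coordinates), and let $R=[\rho_{jk}]=LL^\dagger$ be the corresponding complex correlation matrix. Let $|J^{(c)}|$ be the absolute value of the determinant of the Jacobian matrix of the map sending $\theta$ to the $N(N-1)$ real variables $\mathrm{Re}\,\rho_{jk},\ \mathrm{Im}\,\rho_{jk}$ $(1\le k<j\le N)$. This map is differentiable, and for all angles in $[0,\pi]$ $$|J^{(c)}|=\prod_{j=2}^{N}\prod_{p=1}^{2j-2}(\sin\theta_{jp})^{2N-p-1}.$$ (Quaternion case.) For real angles $\theta=(\theta_{jp})_{2\le j\le N,\ 1\le p\le 4j-4}$ let $L$ be the quaternion lower triangular $N\times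 N$ matrix whose entry $l_{jk}$, $1\le k\le j-1$, has the four real components $$l_{jk}^{s}=\cos\theta_{j,4(k-1)+s}\prod_{p=1}^{4(k-1)+s-1}\sin\theta_{jp}\qquad(s=1,2,3,4),$$ and whose diagonal entries are the real numbers $l_{jj}=\prod_{p=1}^{4j-4}\sin\theta_{jp}$ (each row is a point of the unit sphere of $\mathbb R^{4j-3}$). Here a quaternion with components $(a,b,c,d)$ is $a+b\mathbf i+c\mathbf j+d\mathbf k$, represented by the block $\begin{bmatrix}z&w\\-\overline w&\overline z\end{bmatrix}$ with $z=a+ib$, $w=c+id$. Let $R=[\rho_{jk}]=LL^\dagger$, and let $|J^{(q)}|$ be the absolute value of the determinant of the Jacobian matrix of the map sending $\theta$ to the $2N(N-1)$ real components of the entries $\rho_{jk}$ $(1\le k<j\le N)$. This map is differentiable, and for all angles in $[0,\pi]$ $$|J^{(q)}|=\prod_{j=2}^{N}\prod_{p=1}^{4j-4}(\sin\theta_{jp})^{4N-p-3}.$$ -/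

import Mathlib

open scoped Matrix Quaternion

noncomputable section

/-- Coordinates `p = 0, …, m - 1` of the hyperspherical parametrisation of the unit sphere in
`ℝ^(m+1)` by `m` angles: `cos φ_p * ∏_{q < p} sin φ_q`. -/
def sphereCoord {m : ℕ} (φ : Fin m → ℝ) (p : Fin m) : ℝ :=
  Real.cos (φ p) * ∏ q ∈ Finset.Iio p, Real.sin (φ q)

/-- The last coordinate of the hyperspherical parametrisation of the unit sphere in `ℝ^(m+1)`
by `m` angles: the product of all the sines. -/
def sphereLast {m : ℕ} (φ : Fin m → ℝ) : ℝ :=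
  ∏ q, Real.sin (φ q)

/-- Real coordinates attached to the strictly lower triangular positions of an `N × N` matrix
whose entries have `β` real components. Rows are numbered from `0`: row `j` has `j` strictly lower
triangular entries, hence `j * β` coordinates; the coordinate `β * k + s` of row `j` is the
component `s` of the entry in column `k`. The same index set serves for the angles `θ_{jp}`,
as row `j` of the Cholesky factor is given by `j * β` angles. -/
abbrev LowerIdx (N β : ℕ) : Type := Σ j : Fin N, Fin ((j : ℕ) * β)

/-- The column of a strictly lower triangular coordinate. -/
def LowerIdx.col {N β : ℕ} (a : LowerIdx N β) : Fin N :=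
  Fin.castLE a.1.isLt.le a.2.divNat

/-- The component (from `0` to `β - 1`) singled out by a strictly lower triangular coordinate. -/
def LowerIdx.comp {N β : ℕ} (a : LowerIdx N β) : Fin β :=
  a.2.modNat

/-- The component `s` of the entry in column `k < j` of row `j` of the Cholesky factor, in
hyperspherical coordinates: the sphere coordinate number `β * k + s` of that row. -/
def choleskyComp {N β : ℕ} (θ : LowerIdx N β → ℝ) (j : Fin N) (k : Fin (j : ℕ)) (s : Fin β) : ℝ :=
  sphereCoord (fun p => θ ⟨j, p⟩) (finProdFinEquiv (k, s))

/-- The diagonal entry of row `j` of the Cholesky factor: the last sphere coordinate. -/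
def choleskyDiag {N β : ℕ} (θ : LowerIdx N β → ℝ) (j : Fin N) : ℝ :=
  sphereLast (fun p => θ ⟨j, p⟩)

/-- The complex lower triangular Cholesky factor with hyperspherical rows. -/
def complexCholesky {N : ℕ} (θ : LowerIdx N 2 → ℝ) : Matrix (Fin N) (Fin N) ℂ :=
  Matrix.of fun j k =>
    if h : (k : ℕ) < j then ⟨choleskyComp θ j ⟨k, h⟩ 0, choleskyComp θ j ⟨k, h⟩ 1⟩
    else if k = j then ((choleskyDiag θ j : ℝ) : ℂ)
    else 0

/-- The quaternion lower triangular Cholesky factor with hyperspherical rows. The quaternion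
`a + b i + c j + d k` stands for the block `!![z, w; -conj w, conj z]` with
`z = a + b i`, `w = c + d i`. -/
def quaternionCholesky {N : ℕ} (θ : LowerIdx N 4 → ℝ) : Matrix (Fin N) (Fin N) ℍ[ℝ] :=
  Matrix.of fun j k =>
    if h : (k : ℕ) < j then
      ⟨choleskyComp θ j ⟨k, h⟩ 0, choleskyComp θ j ⟨k, h⟩ 1,
        choleskyComp θ j ⟨k, h⟩ 2, choleskyComp θ j ⟨k, h⟩ 3⟩
    else if k = j then ((choleskyDiag θ j : ℝ) : ℍ[ℝ])
    else 0

/-- The complex correlation matrix `R = L Lᴴ` with Cholesky factor `L` given by the angles. -/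
def complexCorrelation {N : ℕ} (θ : LowerIdx N 2 → ℝ) : Matrix (Fin N) (Fin N) ℂ :=
  complexCholesky θ * (complexCholesky θ)ᴴ

/-- The quaternion correlation matrix `R = L Lᴴ` with Cholesky factor `L` given by the angles. -/
def quaternionCorrelation {N : ℕ} (θ : LowerIdx N 4 → ℝ) : Matrix (Fin N) (Fin N) ℍ[ℝ] :=
  quaternionCholesky θ * (quaternionCholesky θ)ᴴ

/-- The independent real variables of the complex correlation matrix, as functions of the angles:
the real and imaginary parts of the entries `ρ_{jk}`, `k < j`. -/
def complexRho {N : ℕ} (θ : LowerIdx N 2 → ℝ) : LowerIdx N 2 → ℝ := fun a =>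
  ![(complexCorrelation θ a.1 a.col).re, (complexCorrelation θ a.1 a.col).im] a.comp

/-- The independent real variables of the quaternion correlation matrix, as functions of the
angles: the four real components of the entries `ρ_{jk}`, `k < j`. -/
def quaternionRho {N : ℕ} (θ : LowerIdx N 4 → ℝ) : LowerIdx N 4 → ℝ := fun a =>
  ![(quaternionCorrelation θ a.1 a.col).re, (quaternionCorrelation θ a.1 a.col).imI,
    (quaternionCorrelation θ a.1 a.col).imJ, (quaternionCorrelation θ a.1 a.col).imK] a.comp

/-- The Jacobian matrix of a map at a point: the matrix of its partial derivatives. -/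
def jacobianMatrix {ι : Type*} [Fintype ι] [DecidableEq ι] (F : (ι → ℝ) → (ι → ℝ)) (x : ι → ℝ) :
    Matrix ι ι ℝ :=
  Matrix.of fun a b => fderiv ℝ F x (Pi.single b 1) a

/-- The Jacobian: the absolute value of the determinant of the Jacobian matrix. -/
def absJacobian {ι : Type*} [Fintype ι] [DecidableEq ι] (F : (ι → ℝ) → (ι → ℝ)) (x : ι → ℝ) : ℝ :=
  |(jacobianMatrix F x).det|

end

/-! Order the coordinates lexicographically, by row and then by position in the row. For `k < j`,
`ρ_jk = l_kk l_jk + ∑_{l<k} l_jl l_kl*`, where row `k` precedes row `j` and the `l_jl` with `l < k`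
use only earlier angles of row `j`. So each coordinate of `ρ` depends only on angles up to its own
index, and the Jacobian matrix is lower triangular (`rhoOf_update_of_lt`).

The diagonal entry at position `p` of row `j`, in column `k`, is `-l_kk ∏_{q≤p} sin θ_jq`
(`hasDerivAt_rhoOf_update`). It remains to count the sines in the product of these entries
(`prod_choleskyDiag_mul_prod_sin`). The argument is uniform in the number `β` of real components. -/

theorem absJacobian_eq_abs_prod_of_forall_lt {ι α : Type*} [Fintype ι] [DecidableEq ι]
    [LinearOrder α] (r : ι → α) (hr : Function.Injective r) (F : (ι → ℝ) → ι → ℝ) (x : ι → ℝ)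
    (hF : DifferentiableAt ℝ F x) (hlt : ∀ a b, r a < r b → ∀ t, F (Function.update x b t) a = F x a)
    (d : ι → ℝ) (hd : ∀ a, HasDerivAt (fun t => F (Function.update x a t) a) (d a) (x a)) :
    absJacobian F x = |∏ a, d a| := by
  have key : ∀ a b, HasDerivAt (fun t => F (Function.update x b t) a)
      (jacobianMatrix F x a b) (x b) := by
    intro a b
    have h1 : HasFDerivAt F (fderiv ℝ F x) (Function.update x b (x b)) := by
      simpa using hF.hasFDerivAt
    have h2 := h1.comp_hasDerivAt (x b) (hasDerivAt_update x b (x b))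
    exact hasDerivAt_pi.1 h2 a
  let : LinearOrder ι := LinearOrder.lift' r hr
  -- Above the diagonal the partial derivative is that of a constant function.
  have htri : (jacobianMatrix F x).BlockTriangular OrderDual.toDual := by
    intro a b hab
    have h := key a b
    have hab' : r a < r b := hab
    simp only [hlt a b hab'] at h
    exact h.unique (hasDerivAt_const _ _)
  unfold absJacobian
  rw [Matrix.det_of_isLowerTriangular _ htri]
  congr 1
  exact Finset.prod_congr rfl fun a _ => (key a a).unique (hd a)

/-! ### Hyperspherical coordinates -/

theorem differentiable_sphereCoord {m : ℕ} (p : Fin m) :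
    Differentiable ℝ fun φ : Fin m → ℝ => sphereCoord φ p := by
  unfold sphereCoord; fun_prop

theorem differentiable_sphereLast {m : ℕ} :
    Differentiable ℝ fun φ : Fin m → ℝ => sphereLast φ := by
  unfold sphereLast; fun_prop

theorem sphereCoord_congr {m : ℕ} {φ ψ : Fin m → ℝ} {p : Fin m} (h : ∀ q ≤ p, φ q = ψ q) :
    sphereCoord φ p = sphereCoord ψ p := by
  unfold sphereCoord
  rw [h p le_rfl]
  congr 1
  exact Finset.prod_congr rfl fun q hq => by rw [h q (Finset.mem_Iio.1 hq).le]

theorem hasDerivAt_sphereCoord_update {m : ℕ} (φ : Fin m → ℝ) (p : Fin m) :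
    HasDerivAt (fun t => sphereCoord (Function.update φ p t) p)
      (-∏ q ∈ Finset.Iic p, Real.sin (φ q)) (φ p) := by
  have h : ∀ t, sphereCoord (Function.update φ p t) p =
      Real.cos t * ∏ q ∈ Finset.Iio p, Real.sin (φ q) := by
    intro t
    unfold sphereCoord
    rw [Function.update_self]
    congr 1
    exact Finset.prod_congr rfl fun q hq => by
      rw [Function.update_of_ne (Finset.mem_Iio.1 hq).ne]
  simp only [h]
  convert! (Real.hasDerivAt_cos (φ p)).mul_const _ using 1
  rw [← Finset.Iio_insert, Finset.prod_insert (by simp), neg_mul]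

/-! ### Counting factors in products -/

theorem Fin.prod_prod_Iic_eq {M : Type*} [CommMonoid M] {n : ℕ} (f : Fin n → M) :
    ∏ p, ∏ q ∈ Finset.Iic p, f q = ∏ q : Fin n, f q ^ (n - (q : ℕ)) := by
  rw [Finset.prod_comm' (t' := Finset.univ) (s' := fun q => Finset.Ici q) (by simp)]
  simp

/-- Column `k` has `N - 1 - k` entries below the diagonal, with `β` components each. -/
theorem prod_lowerIdx_col {M : Type*} [CommMonoid M] {N β : ℕ} (f : Fin N → M) :
    ∏ a : LowerIdx N β, f a.col = ∏ k : Fin N, f k ^ (β * (N - 1 - (k : ℕ))) := by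
  rw [Fintype.prod_sigma]
  have h : ∀ j : Fin N, ∏ p : Fin ((j : ℕ) * β), f (LowerIdx.col ⟨j, p⟩) =
      ∏ k ∈ Finset.Iio j, f k ^ β := by
    intro j
    rw [← finProdFinEquiv.prod_comp, Fintype.prod_prod_type]
    have h1 : ∀ k : Fin (j : ℕ), ∀ s : Fin β,
        LowerIdx.col (N := N) ⟨j, finProdFinEquiv (k, s)⟩ = Fin.castLE j.isLt.le k := by
      intro k s
      have := congrArg Prod.fst (finProdFinEquiv.symm_apply_apply (k, s))
      exact congrArg (Fin.castLE j.isLt.le) this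
    simp only [h1, Finset.prod_const, Finset.card_univ, Fintype.card_fin]
    refine Finset.prod_bij (fun k _ => Fin.castLE j.isLt.le k) ?_ ?_ ?_ ?_
    · intro k _
      exact Finset.mem_Iio.2 (Fin.lt_def.2 k.isLt)
    · intro k _ l _ h; simpa using h
    · intro k hk
      exact ⟨⟨k, Fin.lt_def.1 (Finset.mem_Iio.1 hk)⟩, Finset.mem_univ _, rfl⟩
    · exact fun _ _ => rfl
  simp only [h]
  rw [Finset.prod_comm' (t' := Finset.univ) (s' := fun q => Finset.Ioi q) (by simp)]
  simp [pow_mul]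


/-! ### Cholesky factor and correlation matrix over a real star algebra -/

section NormedStarAlgebra

variable {N β : ℕ} {R : Type*} [NormedRing R] [NormedAlgebra ℝ R]

/-- The lower triangular Cholesky factor with hyperspherical rows over a real algebra, the
components of the entries being assembled by `u`. -/
noncomputable def choleskyOf (u : (Fin β → ℝ) →L[ℝ] R) (θ : LowerIdx N β → ℝ) :
    Matrix (Fin N) (Fin N) R :=
  Matrix.of fun j k =>
    if h : (k : ℕ) < j then u (choleskyComp θ j ⟨k, h⟩)
    else if k = j then algebraMap ℝ R (choleskyDiag θ j)
    else 0

theorem choleskyOf_congr_row {u : (Fin β → ℝ) →L[ℝ] R} {θ θ' : LowerIdx N β → ℝ} {j : Fin N}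
    (h : ∀ p, θ ⟨j, p⟩ = θ' ⟨j, p⟩) (k : Fin N) : choleskyOf u θ j k = choleskyOf u θ' j k := by
  have h' : (fun p => θ ⟨j, p⟩) = fun p => θ' ⟨j, p⟩ := funext h
  simp only [choleskyOf, Matrix.of_apply, choleskyDiag]
  unfold choleskyComp
  rw [h']

theorem choleskyOf_congr_of_lt {u : (Fin β → ℝ) →L[ℝ] R} {θ θ' : LowerIdx N β → ℝ} {j k : Fin N}
    (hk : k < j) (h : ∀ p : Fin ((j : ℕ) * β), (p : ℕ) < β * (k + 1) → θ ⟨j, p⟩ = θ' ⟨j, p⟩) :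
    choleskyOf u θ j k = choleskyOf u θ' j k := by
  have hk' : (k : ℕ) < j := hk
  simp only [choleskyOf, Matrix.of_apply, dif_pos hk']
  congr 1
  funext s
  refine sphereCoord_congr fun q hq => h q ?_
  have hq' : (q : ℕ) ≤ s + β * k := hq
  have := s.isLt
  rw [mul_add]; omega

theorem choleskyDiag_congr {θ θ' : LowerIdx N β → ℝ} {j : Fin N}
    (h : ∀ p, θ ⟨j, p⟩ = θ' ⟨j, p⟩) : choleskyDiag θ j = choleskyDiag θ' j :=
  congrArg sphereLast (funext h)

theorem LowerIdx.col_lt (a : LowerIdx N β) : a.col < a.1 :=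
  Fin.lt_def.2 a.2.divNat.isLt

theorem LowerIdx.mul_col_le (a : LowerIdx N β) : β * (a.col : ℕ) ≤ a.2 :=
  Nat.mul_div_le _ _

theorem choleskyComp_col_comp (θ : LowerIdx N β → ℝ) (a : LowerIdx N β) :
    choleskyComp θ a.1 ⟨a.col, a.col_lt⟩ a.comp = sphereCoord (fun p => θ ⟨a.1, p⟩) a.2 :=
  congrArg (sphereCoord _) (finProdFinEquiv.apply_symm_apply a.2)

theorem choleskyDiag_col_update (θ : LowerIdx N β → ℝ) {a b : LowerIdx N β}
    (hab : a.1 ≤ b.1) (t : ℝ) :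
    choleskyDiag (Function.update θ b t) a.col = choleskyDiag θ a.col :=
  choleskyDiag_congr fun p => Function.update_of_ne
    (by rintro rfl; exact absurd a.col_lt hab.not_gt) _ _

theorem differentiable_choleskyOf (u : (Fin β → ℝ) →L[ℝ] R) (j k : Fin N) :
    Differentiable ℝ fun θ : LowerIdx N β → ℝ => choleskyOf u θ j k := by
  simp only [choleskyOf, Matrix.of_apply]
  split_ifs with h1 h2
  · refine u.differentiable.comp (differentiable_pi.2 fun s => ?_)
    exact (differentiable_sphereCoord _).comp
      (differentiable_pi.2 fun p => differentiable_apply (𝕜 := ℝ) (⟨j, p⟩ : LowerIdx N β))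
  · refine (algebraMapCLM ℝ R).differentiable.comp ?_
    exact differentiable_sphereLast.comp
      (differentiable_pi.2 fun p => differentiable_apply (𝕜 := ℝ) (⟨j, p⟩ : LowerIdx N β))
  · exact differentiable_const _

/-- `sin θ_jp` occurs once in `l_jj`, which is used by every coordinate of column `j`, and once for
each position of row `j` from `p` on. -/
theorem prod_choleskyDiag_mul_prod_sin (θ : LowerIdx N β → ℝ) :
    ∏ a : LowerIdx N β, (choleskyDiag θ a.col * ∏ q ∈ Finset.Iic a.2, Real.sin (θ ⟨a.1, q⟩)) =
      ∏ j : Fin N, ∏ p : Fin ((j : ℕ) * β),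
        Real.sin (θ ⟨j, p⟩) ^ (β * (N - 1 - (j : ℕ)) + ((j : ℕ) * β - (p : ℕ))) := by
  rw [Finset.prod_mul_distrib, prod_lowerIdx_col (choleskyDiag θ), Fintype.prod_sigma,
    ← Finset.prod_mul_distrib]
  refine Finset.prod_congr rfl fun j _ => ?_
  simp only
  rw [Fin.prod_prod_Iic_eq fun q => Real.sin (θ ⟨j, q⟩)]
  simp only [choleskyDiag, sphereLast]
  rw [← Finset.prod_pow, ← Finset.prod_mul_distrib]
  simp only [pow_add]

variable [StarRing R]

/-- The components of the strictly lower triangular entries of `L Lᴴ`. -/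
noncomputable def rhoOf (e : R ≃L[ℝ] (Fin β → ℝ)) (θ : LowerIdx N β → ℝ) : LowerIdx N β → ℝ :=
  fun a => e ((choleskyOf (e.symm : (Fin β → ℝ) →L[ℝ] R) θ *
    (choleskyOf (e.symm : (Fin β → ℝ) →L[ℝ] R) θ)ᴴ : Matrix (Fin N) (Fin N) R) a.1 a.col) a.comp

/-- Triangularity cuts the sum off at `l = k`. The diagonal entry is a real scalar, hence central
and self-adjoint, so the last term is a scalar multiple even when `R` is noncommutative. -/
theorem choleskyOf_mul_conjTranspose_apply [StarModule ℝ R] (u : (Fin β → ℝ) →L[ℝ] R)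
    (θ : LowerIdx N β → ℝ) {j k : Fin N} (hk : (k : ℕ) < j) :
    (choleskyOf u θ * (choleskyOf u θ)ᴴ) j k =
      choleskyDiag θ k • u (choleskyComp θ j ⟨k, hk⟩) +
        ∑ l ∈ Finset.Iio k, choleskyOf u θ j l * star (choleskyOf u θ k l) := by
  rw [Matrix.mul_apply]
  simp only [Matrix.conjTranspose_apply]
  rw [← Finset.sum_subset (Finset.subset_univ (Finset.Iic k)), ← Finset.Iio_insert,
    Finset.sum_insert (by simp)]
  · congr 1
    simp only [choleskyOf, Matrix.of_apply, dif_pos hk, lt_irrefl, dite_false, if_true]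
    rw [← algebraMap_star_comm, star_trivial, ← Algebra.commutes, Algebra.smul_def]
  · intro l _ hl
    have hl' : k < l := by simpa using hl
    have : choleskyOf u θ k l = 0 := by
      simp only [choleskyOf, Matrix.of_apply]
      rw [dif_neg (by simpa using hl'.le), if_neg hl'.ne']
    rw [this, star_zero, mul_zero]

theorem rhoOf_apply [StarModule ℝ R] (e : R ≃L[ℝ] (Fin β → ℝ)) (θ : LowerIdx N β → ℝ)
    (a : LowerIdx N β) :
    rhoOf e θ a = choleskyDiag θ a.col * sphereCoord (fun p => θ ⟨a.1, p⟩) a.2 +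
      e (∑ l ∈ Finset.Iio a.col, choleskyOf (e.symm : (Fin β → ℝ) →L[ℝ] R) θ a.1 l *
        star (choleskyOf (e.symm : (Fin β → ℝ) →L[ℝ] R) θ a.col l)) a.comp := by
  unfold rhoOf
  rw [choleskyOf_mul_conjTranspose_apply _ _ (Fin.lt_def.1 a.col_lt), ← choleskyComp_col_comp]
  simp

/-- The case `b = a` is included: it makes the sum a constant in the diagonal derivative. -/
theorem rhoOf_sum_update (e : R ≃L[ℝ] (Fin β → ℝ)) (θ : LowerIdx N β → ℝ)
    {a b : LowerIdx N β} (hab : toLex a ≤ toLex b) (t : ℝ) :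
    ∑ l ∈ Finset.Iio a.col,
        choleskyOf (e.symm : (Fin β → ℝ) →L[ℝ] R) (Function.update θ b t) a.1 l *
        star (choleskyOf (e.symm : (Fin β → ℝ) →L[ℝ] R) (Function.update θ b t) a.col l) =
      ∑ l ∈ Finset.Iio a.col, choleskyOf (e.symm : (Fin β → ℝ) →L[ℝ] R) θ a.1 l *
        star (choleskyOf (e.symm : (Fin β → ℝ) →L[ℝ] R) θ a.col l) := by
  have hle : a.1 ≤ b.1 := by
    rcases Sigma.Lex.le_def.1 hab with h | ⟨h, -⟩
    · exact h.le
    · exact h.le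
  refine Finset.sum_congr rfl fun l hl => ?_
  have hl' : l < a.col := Finset.mem_Iio.1 hl
  rw [choleskyOf_congr_row (j := a.col) (θ' := θ) (fun p => Function.update_of_ne ?_ _ _),
    choleskyOf_congr_of_lt (hl'.trans a.col_lt) (θ' := θ) fun p hp => Function.update_of_ne ?_ _ _]
  · rintro rfl
    have h2 : (a.2 : ℕ) ≤ p := by
      rcases Sigma.Lex.le_def.1 hab with h | ⟨_, h⟩
      · exact absurd h (lt_irrefl _)
      · exact h
    -- Column `l` uses only angles below `β * (l + 1)`, all strictly before `a.2`.
    have h3 : β * ((l : ℕ) + 1) ≤ β * a.col := Nat.mul_le_mul_left _ (Fin.lt_def.1 hl')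
    have := a.mul_col_le
    omega
  · rintro rfl
    exact absurd a.col_lt hle.not_gt

theorem rhoOf_update_of_lt [StarModule ℝ R] (e : R ≃L[ℝ] (Fin β → ℝ)) (θ : LowerIdx N β → ℝ)
    {a b : LowerIdx N β} (hab : toLex a < toLex b) (t : ℝ) :
    rhoOf e (Function.update θ b t) a = rhoOf e θ a := by
  have hle : a.1 ≤ b.1 := by
    rcases Sigma.Lex.lt_def.1 hab with h | ⟨h, -⟩
    · exact h.le
    · exact h.le
  rw [rhoOf_apply, rhoOf_apply, rhoOf_sum_update e θ hab.le, choleskyDiag_col_update θ hle]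
  congr 2
  refine sphereCoord_congr fun q hq => Function.update_of_ne ?_ _ _
  rintro rfl
  rcases Sigma.Lex.lt_def.1 hab with h | ⟨_, h⟩
  · exact absurd h (lt_irrefl _)
  · exact absurd h hq.not_gt

theorem hasDerivAt_rhoOf_update [StarModule ℝ R] (e : R ≃L[ℝ] (Fin β → ℝ))
    (θ : LowerIdx N β → ℝ) (a : LowerIdx N β) :
    HasDerivAt (fun t => rhoOf e (Function.update θ a t) a)
      (choleskyDiag θ a.col * -∏ q ∈ Finset.Iic a.2, Real.sin (θ ⟨a.1, q⟩)) (θ a) := by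
  have hrow : ∀ t, (fun p => Function.update θ a t ⟨a.1, p⟩) =
      Function.update (fun p => θ ⟨a.1, p⟩) a.2 t := by
    intro t
    funext p
    by_cases hp : p = a.2
    · subst hp; simp
    · rw [Function.update_of_ne hp, Function.update_of_ne]
      intro h
      exact hp (eq_of_heq (Sigma.ext_iff.1 h).2)
  simp only [rhoOf_apply, rhoOf_sum_update e θ (le_refl (toLex a)),
    choleskyDiag_col_update θ (le_refl a.1), hrow]
  exact ((hasDerivAt_sphereCoord_update (fun p => θ ⟨a.1, p⟩) a.2).const_mul _).add_const _

theorem differentiable_rhoOf [StarModule ℝ R] [ContinuousStar R] (e : R ≃L[ℝ] (Fin β → ℝ)) :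
    Differentiable ℝ (rhoOf e : (LowerIdx N β → ℝ) → LowerIdx N β → ℝ) := by
  refine differentiable_pi.2 fun a => ?_
  refine differentiable_pi.1 (e.differentiable.comp (?_ : Differentiable ℝ fun θ =>
    (choleskyOf (e.symm : (Fin β → ℝ) →L[ℝ] R) θ *
      (choleskyOf (e.symm : (Fin β → ℝ) →L[ℝ] R) θ)ᴴ : Matrix (Fin N) (Fin N) R) a.1 a.col)) a.comp
  simp only [Matrix.mul_apply, Matrix.conjTranspose_apply]
  refine Differentiable.fun_sum fun l _ => Differentiable.fun_mul
    (differentiable_choleskyOf _ _ _) ?_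
  exact (starL' ℝ : R ≃L[ℝ] R).differentiable.comp (differentiable_choleskyOf _ _ _)

theorem absJacobian_rhoOf [StarModule ℝ R] [ContinuousStar R] (e : R ≃L[ℝ] (Fin β → ℝ))
    (θ : LowerIdx N β → ℝ) (hθ : ∀ a, θ a ∈ Set.Icc 0 Real.pi) :
    absJacobian (rhoOf e) θ = ∏ j : Fin N, ∏ p : Fin ((j : ℕ) * β),
      Real.sin (θ ⟨j, p⟩) ^ (β * (N - 1 - (j : ℕ)) + ((j : ℕ) * β - (p : ℕ))) := by
  have hsin : ∀ a, 0 ≤ Real.sin (θ a) := fun a => Real.sin_nonneg_of_mem_Icc (hθ a)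
  rw [absJacobian_eq_abs_prod_of_forall_lt toLex toLex.injective (rhoOf e) θ
    (differentiable_rhoOf e θ) (fun a b hab t => rhoOf_update_of_lt e θ hab t) _
    (hasDerivAt_rhoOf_update e θ), ← prod_choleskyDiag_mul_prod_sin, Finset.abs_prod]
  refine Finset.prod_congr rfl fun a _ => ?_
  rw [mul_neg, abs_neg, abs_of_nonneg]
  have hdiag : 0 ≤ choleskyDiag θ a.col := by
    unfold choleskyDiag sphereLast
    exact Finset.prod_nonneg fun _ _ => hsin _
  exact mul_nonneg hdiag (Finset.prod_nonneg fun _ _ => hsin _)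

end NormedStarAlgebra

/-- Real and imaginary part as a continuous linear equivalence. -/
noncomputable def Complex.tupleCLE : ℂ ≃L[ℝ] (Fin 2 → ℝ) :=
  LinearEquiv.toContinuousLinearEquiv
    { toFun := fun z => ![z.re, z.im]
      invFun := fun v => ⟨v 0, v 1⟩
      map_add' := fun z w => by ext i; fin_cases i <;> rfl
      map_smul' := fun c z => by ext i; fin_cases i <;> simp
      left_inv := fun _ => rfl
      right_inv := fun v => by ext i; fin_cases i <;> rfl }

/-- The four components of a quaternion as a continuous linear equivalence. -/
noncomputable def Quaternion.tupleCLE : ℍ[ℝ] ≃L[ℝ] (Fin 4 → ℝ) :=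
  LinearEquiv.toContinuousLinearEquiv
    (QuaternionAlgebra.linearEquivTuple (-1 : ℝ) (0 : ℝ) (-1 : ℝ))

theorem Quaternion.starModule_real : StarModule ℝ ℍ[ℝ] :=
  ⟨fun r q => by rw [Quaternion.star_smul, star_trivial r]⟩

theorem complexRho_eq_rhoOf {N : ℕ} : complexRho (N := N) = rhoOf Complex.tupleCLE := rfl

theorem quaternionRho_eq_rhoOf {N : ℕ} :
    quaternionRho (N := N) = rhoOf Quaternion.tupleCLE := rfl

/-- Rows and angles are numbered from `0`, so `p + 1` in the exponents is the usual number of the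
angle in its row, counted from `1`; the row numbered `0` contributes an empty product. -/
theorem mainTheorem6 (N : ℕ) :
    (∀ θ : LowerIdx N 2 → ℝ, (∀ a, θ a ∈ Set.Icc 0 Real.pi) →
      DifferentiableAt ℝ (complexRho (N := N)) θ ∧
      absJacobian (complexRho (N := N)) θ =
        ∏ j : Fin N, ∏ p : Fin ((j : ℕ) * 2),
          Real.sin (θ ⟨j, p⟩) ^ (2 * N - ((p : ℕ) + 1) - 1)) ∧
    (∀ θ : LowerIdx N 4 → ℝ, (∀ a, θ a ∈ Set.Icc 0 Real.pi) →
      DifferentiableAt ℝ (quaternionRho (N := N)) θ ∧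
      absJacobian (quaternionRho (N := N)) θ =
        ∏ j : Fin N, ∏ p : Fin ((j : ℕ) * 4),
          Real.sin (θ ⟨j, p⟩) ^ (4 * N - ((p : ℕ) + 1) - 3)) := by
  refine ⟨fun θ hθ => ?_, fun θ hθ => ?_⟩
  · rw [complexRho_eq_rhoOf]
    refine ⟨differentiable_rhoOf _ θ, (absJacobian_rhoOf _ θ hθ).trans ?_⟩
    refine Finset.prod_congr rfl fun j _ => Finset.prod_congr rfl fun p _ => ?_
    congr 1
    have := j.isLt
    have := p.isLt
    -- Both exponents equal `β (N - 1) - p`; no subtraction truncates, since `p < j β` and `j ≤ N -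
    -- 1`.
    omega
  · have := Quaternion.starModule_real
    rw [quaternionRho_eq_rhoOf]
    refine ⟨differentiable_rhoOf _ θ, (absJacobian_rhoOf _ θ hθ).trans ?_⟩
    refine Finset.prod_congr rfl fun j _ => Finset.prod_congr rfl fun p _ => ?_
    congr 1
    have := j.isLt
    have := p.isLt
    omega
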